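/- **Corollary (A New Character of the Real Heisenberg Lie Algebras).** A finite-dimensional real Lie group $G$ with Lie algebra $\mathfrak g$ acts on the dual space $\mathfrak g^*$ by the coadjoint representation $\langle K(g)F, X\rangle = \langle F, \mathrm{Ad}(g^{-1})X\rangle$; the orbits are called the coadjoint orbits of $G$. An *MDn-group* is an $n$-dimensional solvable real Lie group each of whose coadjoint orbits has dimension either zero or equal to the maximal dimension of the coadjoint orbits of the group; an *MDn-algebra* is a real Lie algebra isomorphic to the Lie algebra of an MDn-group. For $0 < m < n$, an *MD(n,m)-algebra* is an MDn-algebra whose first derived ideal $[\mathcal G,\mathcal G]$ has dimension $m$. A nonzero Lie algebra is *indecomposable* if it is not the direct sum of two nonzero ideals. For $m \ge 1$, the $(2m+1)$-dimensional real Heisenberg Lie algebra $\mathfrak h_{2m+1}$ has a basis $X_1,\dots,X_m,Y_1,\dots,Y_m,Z$ with $[X_i,Y_i]=Z$ for $i=1,\dots,m$, all other brackets of basis vectors being trivial. Let $\mathcal G$ be a real Lie algebra of dimension $n \ge 3$. Then the following conditions are equivalent: (i) $\mathcal G$ is indecomposable and its first derived ideal $[\mathcal G,\mathcal G]$ is 1-dimensional;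 (ii) $\mathcal G$ is an indecomposable MD(n,1)-algebra; (iii) $\mathcal G$ is isomorphic to the $n$-dimensional real Heisenberg Lie algebra, i.e. $n = 2m+1$ for some $m \ge 1$ and $\mathcal G \cong \mathfrak h_{2m+1}$. In particular, if $\mathcal G$ is isomorphic to a real Heisenberg Lie algebra, then $n$ is odd. -/

import Mathlib

open scoped Manifold ContDiff

noncomputable section

/-! ### Coadjoint orbits of a real Lie group -/

/-- A smooth real Lie group satisfies the smoothness hypothesis under which Mathlib endows
`GroupLieAlgebra` with its Lie algebra structure. -/
instance lieGroupMinSmoothnessThree {n : ℕ} {G : Type*} [TopologicalSpace G]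
    [ChartedSpace (EuclideanSpace ℝ (Fin n)) G] [Group G] [LieGroup (𝓡 n) ∞ G] :
    LieGroup (𝓡 n) (minSmoothness ℝ 3) G :=
  LieGroup.of_le (n := ∞) (by
    rw [minSmoothness_of_isRCLikeNormedField]
    exact ENat.LEInfty.out)

/-- The adjoint representation of an `n`-dimensional Lie group `G`: `Ad g` is the tangent map at
the identity of the inner automorphism `x ↦ g x g⁻¹`, as an endomorphism of the Lie algebra
`T₁G`. As everywhere in Mathlib, every tangent space of `G` is a copy of the model
space `ℝⁿ`. -/
def lieGroupAd (n : ℕ) {G : Type*} [TopologicalSpace G]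
    [ChartedSpace (EuclideanSpace ℝ (Fin n)) G] [Group G] (g : G) :
    EuclideanSpace ℝ (Fin n) →L[ℝ] EuclideanSpace ℝ (Fin n) :=
  mfderiv (𝓡 n) (𝓡 n) (fun x : G => g * x * g⁻¹) 1

/-- The coadjoint representation `K` of `G` in the dual of its Lie algebra:
`⟨K g F, X⟩ = ⟨F, Ad g⁻¹ X⟩`. -/
def coadjoint (n : ℕ) {G : Type*} [TopologicalSpace G]
    [ChartedSpace (EuclideanSpace ℝ (Fin n)) G] [Group G] (g : G)
    (F : StrongDual ℝ (EuclideanSpace ℝ (Fin n))) :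
    StrongDual ℝ (EuclideanSpace ℝ (Fin n)) :=
  F.comp (lieGroupAd n g⁻¹)

/-- The dimension of the coadjoint orbit `Ω_F = {K g F | g ∈ G}` of `F`. The orbit is an immersed
submanifold of the dual space, parametrised by the orbit map `g ↦ K g F` (which has constant
rank); its dimension is that of its tangent space at `F`, the image of the differential at the
identity of the orbit map. -/
def coadjointOrbitDim (n : ℕ) (G : Type*) [TopologicalSpace G]
    [ChartedSpace (EuclideanSpace ℝ (Fin n)) G] [Group G]
    (F : StrongDual ℝ (EuclideanSpace ℝ (Fin n))) : ℕ :=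
  Module.finrank ℝ (LinearMap.range
    (mfderiv (𝓡 n) 𝓘(ℝ, StrongDual ℝ (EuclideanSpace ℝ (Fin n)))
      (fun g : G => coadjoint n g F) 1 :
      EuclideanSpace ℝ (Fin n) →L[ℝ] StrongDual ℝ (EuclideanSpace ℝ (Fin n))).toLinearMap)

/-- `G` is an `n`-dimensional MD-group: a solvable real Lie group of dimension `n` each of whose
coadjoint orbits has dimension zero or the maximal dimension of the coadjoint orbits of `G`. -/
structure IsMDGroup (n : ℕ) (G : Type*) [TopologicalSpace G]
    [ChartedSpace (EuclideanSpace ℝ (Fin n)) G] [Group G] [LieGroup (𝓡 n) ∞ G] : Prop where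
  t2Space : T2Space G
  secondCountable : SecondCountableTopology G
  solvable : Group.IsSolvable G
  orbitDim : ∀ F : StrongDual ℝ (EuclideanSpace ℝ (Fin n)),
    coadjointOrbitDim n G F = 0 ∨
      ∀ F' : StrongDual ℝ (EuclideanSpace ℝ (Fin n)),
        coadjointOrbitDim n G F' ≤ coadjointOrbitDim n G F

/-! ### Classes of real Lie algebras -/

/-- `L` is an `MDn`-algebra: it is (isomorphic to) the Lie algebra of an `n`-dimensional
MD-group. -/
def IsMDAlgebra (n : ℕ) (L : Type*) [LieRing L] [LieAlgebra ℝ L] : Prop :=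
  ∃ (G : Type) (_ : TopologicalSpace G) (_ : ChartedSpace (EuclideanSpace ℝ (Fin n)) G)
    (_ : Group G) (_ : LieGroup (𝓡 n) ∞ G),
    IsMDGroup n G ∧ Nonempty (L ≃ₗ⁅ℝ⁆ GroupLieAlgebra (𝓡 n) G)

/-- The first derived ideal `[L, L]` of a real Lie algebra. -/
abbrev firstDerivedIdeal (L : Type*) [LieRing L] [LieAlgebra ℝ L] : LieIdeal ℝ L :=
  ⁅(⊤ : LieIdeal ℝ L), (⊤ : LieIdeal ℝ L)⁆

/-- `L` is an `MD(n, m)`-algebra: an `MDn`-algebra whose first derived ideal has dimension `m`,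
where `0 < m < n`. -/
def IsMDAlgebraWithDerivedDim (n m : ℕ) (L : Type*) [LieRing L] [LieAlgebra ℝ L] : Prop :=
  0 < m ∧ m < n ∧ IsMDAlgebra n L ∧ Module.finrank ℝ (firstDerivedIdeal L) = m

/-- `L` is decomposable: it is the direct sum, as a Lie algebra, of two nonzero (hence proper)
ideals. -/
def IsDecomposableLieAlgebra (L : Type*) [LieRing L] [LieAlgebra ℝ L] : Prop :=
  ∃ A B : LieIdeal ℝ L, A ≠ ⊥ ∧ B ≠ ⊥ ∧ IsCompl A B

/-- `L` is indecomposable. (Used for nonzero Lie algebras only.) -/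
def IsIndecomposableLieAlgebra (L : Type*) [LieRing L] [LieAlgebra ℝ L] : Prop :=
  ¬ IsDecomposableLieAlgebra L

/-! ### The real Heisenberg Lie algebras -/

/-- The `(2m+1)`-dimensional real Heisenberg Lie algebra, with basis `Xᵢ`, `Yᵢ` (`i < m`), `Z`;
the element `∑ xᵢ Xᵢ + ∑ yᵢ Yᵢ + z Z` is the triple `(x, y, z)`. -/
@[ext] structure HeisenbergLieAlgebra (m : ℕ) : Type where
  x : Fin m → ℝ
  y : Fin m → ℝ
  z : ℝ

namespace HeisenbergLieAlgebra

variable {m : ℕ}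

/-- Coordinates on the Heisenberg Lie algebra. -/
def coords (m : ℕ) : HeisenbergLieAlgebra m ≃ (Fin m → ℝ) × (Fin m → ℝ) × ℝ where
  toFun u := (u.x, u.y, u.z)
  invFun p := ⟨p.1, p.2.1, p.2.2⟩

instance : AddCommGroup (HeisenbergLieAlgebra m) := (coords m).addCommGroup

instance : Module ℝ (HeisenbergLieAlgebra m) := (coords m).module ℝ

@[simp] theorem add_x (u v : HeisenbergLieAlgebra m) : (u + v).x = u.x + v.x := rfl
@[simp] theorem add_y (u v : HeisenbergLieAlgebra m) : (u + v).y = u.y + v.y := rfl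
@[simp] theorem add_z (u v : HeisenbergLieAlgebra m) : (u + v).z = u.z + v.z := rfl
@[simp] theorem smul_x (c : ℝ) (u : HeisenbergLieAlgebra m) : (c • u).x = c • u.x := rfl
@[simp] theorem smul_y (c : ℝ) (u : HeisenbergLieAlgebra m) : (c • u).y = c • u.y := rfl
@[simp] theorem smul_z (c : ℝ) (u : HeisenbergLieAlgebra m) : (c • u).z = c * u.z := rfl
@[simp] theorem zero_x : (0 : HeisenbergLieAlgebra m).x = 0 := rfl
@[simp] theorem zero_y : (0 : HeisenbergLieAlgebra m).y = 0 := rfl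
@[simp] theorem zero_z : (0 : HeisenbergLieAlgebra m).z = 0 := rfl

/-- The bilinear alternating bracket with `[Xᵢ, Yᵢ] = Z`, all other brackets of basis vectors
being trivial. -/
instance : Bracket (HeisenbergLieAlgebra m) (HeisenbergLieAlgebra m) where
  bracket u v := ⟨0, 0, ∑ i, (u.x i * v.y i - u.y i * v.x i)⟩

@[simp] theorem lie_x (u v : HeisenbergLieAlgebra m) : ⁅u, v⁆.x = 0 := rfl
@[simp] theorem lie_y (u v : HeisenbergLieAlgebra m) : ⁅u, v⁆.y = 0 := rfl
@[simp] theorem lie_z (u v : HeisenbergLieAlgebra m) :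
    ⁅u, v⁆.z = ∑ i, (u.x i * v.y i - u.y i * v.x i) := rfl

instance : LieRing (HeisenbergLieAlgebra m) where
  add_lie u v w := by
    ext1
    · simp
    · simp
    · simp only [lie_z, add_x, add_y, add_z, Pi.add_apply, ← Finset.sum_add_distrib]
      exact Finset.sum_congr rfl fun i _ => by ring
  lie_add u v w := by
    ext1
    · simp
    · simp
    · simp only [lie_z, add_x, add_y, add_z, Pi.add_apply, ← Finset.sum_add_distrib]
      exact Finset.sum_congr rfl fun i _ => by ring
  lie_self u := by
    ext1
    · simp
    · simp
    · simp only [lie_z, zero_z]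
      exact Finset.sum_eq_zero fun i _ => by ring
  leibniz_lie u v w := by
    ext1 <;> simp

instance : LieAlgebra ℝ (HeisenbergLieAlgebra m) where
  lie_smul c u v := by
    ext1
    · simp
    · simp
    · simp only [lie_z, smul_x, smul_y, smul_z, Pi.smul_apply, smul_eq_mul, Finset.mul_sum]
      exact Finset.sum_congr rfl fun i _ => by ring

end HeisenbergLieAlgebra

end

/-! Condition (i) says that the bracket is `Ω x y • z` for an alternating form `Ω` and a vector `z`
spanning the derived ideal. By indecomposability every central element lies on the line of `z`, and
dimension at least three together with the Jacobi identity makes `z` itself central. The radical of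
`Ω` is then exactly that line, so the Darboux normal form (`exists_surjective_standardSymplectic`)
supplies Heisenberg coordinates: this is `exists_equiv_heisenberg`.

Conversely, in a Heisenberg algebra every nonzero ideal contains the central line, which rules out
direct sums. The algebra integrates to `ℝⁿ` with the product `x + y + [x, y] / 2`. There the tangent
space to the orbit of `F` consists of the functionals `F(z) Ω(X, ·)`, so its dimension is zero or
the rank of `Ω`: this is `isMDAlgebra_of_central_line`. Passing from (ii) to (i) only forgets the
MD-group. -/

/-! ### Alternating forms -/

/-- The standard symplectic form on `ℝᵐ × ℝᵐ`. -/
def standardSymplectic {m : ℕ} (p q : (Fin m → ℝ) × (Fin m → ℝ)) : ℝ :=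
  ∑ i, (p.1 i * q.2 i - p.2 i * q.1 i)

theorem eq_zero_of_standardSymplectic_eq_zero {m : ℕ} {p : (Fin m → ℝ) × (Fin m → ℝ)}
    (h : ∀ q, standardSymplectic p q = 0) : p = 0 := by
  ext i
  · simpa [standardSymplectic, Pi.single_apply] using h (0, Pi.single i 1)
  · simpa [standardSymplectic, Pi.single_apply] using h (Pi.single i 1, 0)

/-- The radical of an alternating form pulled back from the standard symplectic form along a
surjection is the kernel of the surjection. -/
theorem eq_zero_of_form_eq_zero {V : Type*} [AddCommGroup V] [Module ℝ V] {m : ℕ}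
    {p : V →ₗ[ℝ] (Fin m → ℝ) × (Fin m → ℝ)} (hp : Function.Surjective p)
    {Ω : V →ₗ[ℝ] V →ₗ[ℝ] ℝ} (hΩ : ∀ u v, Ω u v = standardSymplectic (p u) (p v))
    {u : V} (hu : Ω u = 0) : p u = 0 := by
  refine eq_zero_of_standardSymplectic_eq_zero fun q => ?_
  obtain ⟨v, rfl⟩ := hp q
  rw [← hΩ, hu, LinearMap.zero_apply]

/-- Darboux normal form: an alternating form on a finite-dimensional real vector space is the
pullback of a standard symplectic form along a surjective linear map. -/
theorem exists_surjective_standardSymplectic {V : Type*} [AddCommGroup V] [Module ℝ V]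
    [FiniteDimensional ℝ V] (Ω : V →ₗ[ℝ] V →ₗ[ℝ] ℝ) (hΩ : ∀ u, Ω u u = 0) :
    ∃ (m : ℕ) (p : V →ₗ[ℝ] (Fin m → ℝ) × (Fin m → ℝ)), Function.Surjective p ∧
      ∀ u v, Ω u v = standardSymplectic (p u) (p v) := by
  induction hk : Module.finrank ℝ (LinearMap.range Ω) using Nat.strong_induction_on generalizing Ω
    with
  | _ k ih =>
  have hskew : ∀ u v, Ω u v = - Ω v u := fun u v => by
    have h := hΩ (u + v)
    simp only [map_add, LinearMap.add_apply, hΩ] at h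
    linarith
  by_cases h0 : Ω = 0
  · refine ⟨0, 0, fun q => ⟨0, Subsingleton.elim _ _⟩, fun u v => ?_⟩
    simp [h0, standardSymplectic]
  obtain ⟨a, b, hab⟩ : ∃ a b, Ω a b = 1 := by
    have : ∃ a b, Ω a b ≠ 0 := by
      by_contra! h
      exact h0 (LinearMap.ext₂ h)
    obtain ⟨a, b, h⟩ := this
    exact ⟨a, (Ω a b)⁻¹ • b, by simp [h]⟩
  have hba : Ω b a = -1 := by rw [hskew, hab]
  -- `f` and `g` are the coordinates dual to the hyperbolic pair `a`, `b`. Subtracting `f ∧ g` puts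
  -- both vectors in the radical and keeps the old radical, so the rank drops.
  let f : V →ₗ[ℝ] ℝ := -Ω b
  let g : V →ₗ[ℝ] ℝ := Ω a
  let Ω' : V →ₗ[ℝ] V →ₗ[ℝ] ℝ := Ω - (f.smulRight g - g.smulRight f)
  have hΩ' : ∀ u v, Ω' u v = Ω u v - (f u * g v - g u * f v) := fun u v => by simp [Ω']
  have hfa : f a = 1 := by simp [f, hba]
  have hfb : f b = 0 := by simp [f, hΩ]
  have hga : g a = 0 := by simp [g, hΩ]
  have hgb : g b = 1 := by simp [g, hab]
  have ha' : Ω' a = 0 := by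
    ext v
    rw [hΩ', hfa, hga]
    simp [g]
  have hb' : Ω' b = 0 := by
    ext v
    rw [hΩ', hfb, hgb]
    simp [f]
  have hlt : LinearMap.ker Ω < LinearMap.ker Ω' := by
    refine lt_of_le_of_ne (fun u hu => ?_) fun h => ?_
    · rw [LinearMap.mem_ker] at hu ⊢
      ext v
      have h1 : f u = 0 := by simp [f, hskew b u, hu]
      have h2 : g u = 0 := by simp [g, hskew a u, hu]
      simp [hΩ', hu, h1, h2]
    · have : a ∈ LinearMap.ker Ω := h ▸ LinearMap.mem_ker.2 ha'
      rw [LinearMap.mem_ker] at this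
      simp [this] at hab
  have hrank : Module.finrank ℝ (LinearMap.range Ω') < k := by
    have h1 := LinearMap.finrank_range_add_finrank_ker Ω
    have h2 := LinearMap.finrank_range_add_finrank_ker Ω'
    have h3 := Submodule.finrank_lt_finrank_of_lt hlt
    omega
  obtain ⟨m, p, hp, hpΩ⟩ := ih _ hrank Ω' (fun u => by rw [hΩ', hΩ]; ring) rfl
  have hpa := eq_zero_of_form_eq_zero hp hpΩ ha'
  have hpb := eq_zero_of_form_eq_zero hp hpΩ hb'
  let c (h : V →ₗ[ℝ] ℝ) (q : V →ₗ[ℝ] Fin m → ℝ) : V →ₗ[ℝ] Fin (m + 1) → ℝ :=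
    LinearMap.pi (Fin.cons h fun i => LinearMap.proj i ∘ₗ q)
  have hc0 (h q v) : c h q v 0 = h v := by simp [c]
  have hcs (h q v) (i : Fin m) : c h q v i.succ = q v i := by simp [c]
  refine ⟨m + 1, (c f (LinearMap.fst ℝ _ _ ∘ₗ p)).prod (c g (LinearMap.snd ℝ _ _ ∘ₗ p)),
    fun q => ?_, fun u v => ?_⟩
  · obtain ⟨v, hv⟩ := hp (fun i => q.1 i.succ, fun i => q.2 i.succ)
    -- As `p` kills `a` and `b`, adding multiples of them corrects the two new coordinates without
    -- disturbing the old ones.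
    refine ⟨v + (q.1 0 - f v) • a + (q.2 0 - g v) • b, ?_⟩
    ext i <;> refine Fin.cases ?_ (fun j => ?_) i
    · simp [hc0, hfa, hfb]
    · simp [hcs, hpa, hpb, hv]
    · simp [hc0, hga, hgb]
    · simp [hcs, hpa, hpb, hv]
  · have := hpΩ u v
    rw [hΩ'] at this
    rw [sub_eq_iff_eq_add'.1 this]
    simp [hc0, hcs, standardSymplectic, Fin.sum_univ_succ]
    ring

/-! ### Lie algebras with one-dimensional derived ideal -/

section LieAlgebra

variable {𝔤 : Type*} [LieRing 𝔤] [LieAlgebra ℝ 𝔤]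

theorem lie_mem_firstDerivedIdeal (x y : 𝔤) : ⁅x, y⁆ ∈ firstDerivedIdeal 𝔤 :=
  LieSubmodule.lie_mem_lie (LieSubmodule.mem_top x) (LieSubmodule.mem_top y)

/-- A Lie algebra of dimension at least two with a central element outside of the derived ideal
is decomposable. -/
theorem isDecomposable_of_central_notMem [FiniteDimensional ℝ 𝔤]
    (hdim : 2 ≤ Module.finrank ℝ 𝔤) {c : 𝔤} (hc : ∀ x : 𝔤, ⁅x, c⁆ = 0)
    (hcD : c ∉ firstDerivedIdeal 𝔤) : IsDecomposableLieAlgebra 𝔤 := by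
  obtain ⟨f, hfc, hfD⟩ := Submodule.exists_le_ker_of_notMem
    (p := (firstDerivedIdeal 𝔤).toSubmodule) (v := c) hcD
  have hf : ∀ x y : 𝔤, f ⁅x, y⁆ = 0 := fun x y => hfD (lie_mem_firstDerivedIdeal x y)
  have hc0 : c ≠ 0 := by
    rintro rfl
    simp at hfc
  -- The summands are the line of `c`, an ideal by centrality, and the hyperplane `ker f`, an ideal
  -- because it contains all brackets.
  let A : LieIdeal ℝ 𝔤 :=
    { Submodule.span ℝ {c} with
      lie_mem := fun {x m} hm => by
        obtain ⟨t, rfl⟩ := Submodule.mem_span_singleton.1 hm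
        simp [hc] }
  let B : LieIdeal ℝ 𝔤 :=
    { LinearMap.ker f with
      lie_mem := fun {x m} _ => hf x m }
  have hA : ∀ x, x ∈ A ↔ ∃ t : ℝ, t • c = x := fun x => Submodule.mem_span_singleton
  have hB : ∀ x, x ∈ B ↔ f x = 0 := fun x => Iff.rfl
  refine ⟨A, B, fun h => hc0 ?_, fun h => ?_, ?_⟩
  · have : c ∈ A := (hA c).2 ⟨1, one_smul ℝ c⟩
    rwa [h, LieSubmodule.mem_bot] at this
  · have hker : LinearMap.ker f = ⊥ := by
      rw [eq_bot_iff]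
      intro x hx
      have : x ∈ B := hx
      rwa [h, LieSubmodule.mem_bot] at this
    have := LinearMap.finrank_le_finrank_of_injective (LinearMap.ker_eq_bot.1 hker)
    rw [Module.finrank_self] at this
    omega
  · rw [isCompl_iff, disjoint_iff, codisjoint_iff]
    constructor
    · rw [eq_bot_iff]
      rintro x ⟨h1, h2⟩
      obtain ⟨t, rfl⟩ := (hA x).1 h1
      have h3 := (hB _).1 h2
      rw [map_smul, smul_eq_mul, mul_eq_zero] at h3
      rw [LieSubmodule.mem_bot, h3.resolve_right hfc, zero_smul]
    · rw [eq_top_iff]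
      intro x _
      rw [LieSubmodule.mem_sup]
      refine ⟨(f x / f c) • c, (hA _).2 ⟨_, rfl⟩, x - (f x / f c) • c, (hB _).2 ?_, by simp⟩
      simp [hfc]

/-- An indecomposable Lie algebra of dimension at least three with one-dimensional derived ideal
is a Heisenberg Lie algebra. -/
theorem exists_equiv_heisenberg (hdim : 3 ≤ Module.finrank ℝ 𝔤)
    (hind : IsIndecomposableLieAlgebra 𝔤) (hD : Module.finrank ℝ (firstDerivedIdeal 𝔤) = 1) :
    ∃ m : ℕ, 0 < m ∧ Nonempty (𝔤 ≃ₗ⁅ℝ⁆ HeisenbergLieAlgebra m) := by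
  have : FiniteDimensional ℝ 𝔤 := Module.finite_of_finrank_pos (by omega)
  obtain ⟨⟨z, hzD⟩, hz, hspan⟩ := finrank_eq_one_iff'.1 hD
  have hz0 : z ≠ 0 := fun h => hz (Subtype.ext h)
  have hmemD : ∀ w ∈ firstDerivedIdeal 𝔤, ∃ t : ℝ, t • z = w := fun w hw => by
    obtain ⟨t, ht⟩ := hspan ⟨w, hw⟩
    exact ⟨t, congrArg Subtype.val ht⟩
  obtain ⟨ζ, hζ⟩ := Module.Projective.exists_dual_ne_zero ℝ hz0
  obtain ⟨ζ, hζ⟩ : ∃ ζ : Module.Dual ℝ 𝔤, ζ z = 1 := ⟨(ζ z)⁻¹ • ζ, by simp [hζ]⟩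
  let Ω : 𝔤 →ₗ[ℝ] 𝔤 →ₗ[ℝ] ℝ := (LieModule.toEnd ℝ 𝔤 𝔤 : 𝔤 →ₗ[ℝ] Module.End ℝ 𝔤).compr₂ ζ
  have hΩ : ∀ x y, Ω x y = ζ ⁅x, y⁆ := fun x y => rfl
  have hlie : ∀ x y : 𝔤, ⁅x, y⁆ = Ω x y • z := fun x y => by
    obtain ⟨t, ht⟩ := hmemD _ (lie_mem_firstDerivedIdeal x y)
    rw [hΩ, ← ht, map_smul, hζ, smul_eq_mul, mul_one]
  have hcent : ∀ c : 𝔤, (∀ x : 𝔤, ⁅x, c⁆ = 0) → ∃ t : ℝ, t • z = c := fun c hc =>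
    hmemD c (by_contra fun h => hind (isDecomposable_of_central_notMem (by omega) hc h))
  have hzc : ∀ x : 𝔤, ⁅x, z⁆ = 0 := by
    intro x
    by_contra hx
    -- Two linear conditions in dimension at least three leave a nonzero `k` commuting with `x` and
    -- `z`. The Jacobi identity for `x, y, k` reduces to `Ω y k • ⁅x, z⁆ = 0`, so `k` is central,
    -- hence a multiple of `z`; but no nonzero multiple of `z` commutes with `x`.
    obtain ⟨k, hk, hk0⟩ : ∃ k ∈ LinearMap.ker ((Ω x).prod (Ω z)), k ≠ 0 := by
      refine Submodule.exists_mem_ne_zero_of_ne_bot fun h => ?_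
      have := LinearMap.finrank_le_finrank_of_injective (LinearMap.ker_eq_bot.1 h)
      rw [Module.finrank_prod, Module.finrank_self] at this
      omega
    have hk' : Ω x k = 0 ∧ Ω z k = 0 := by simpa using hk
    have hxk : ⁅x, k⁆ = 0 := by rw [hlie, hk'.1, zero_smul]
    have hzk : ⁅z, k⁆ = 0 := by rw [hlie, hk'.2, zero_smul]
    obtain ⟨t, rfl⟩ := hcent k fun y => by
      have h1 := leibniz_lie x y k
      rw [hxk, lie_zero, hlie x y, smul_lie, hzk, smul_zero, add_zero, hlie y k, lie_smul] at h1
      rw [hlie, (smul_eq_zero.1 h1).resolve_right hx, zero_smul]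
    rw [lie_smul] at hxk
    exact hk0 (by rw [(smul_eq_zero.1 hxk).resolve_right hx, zero_smul])
  obtain ⟨m, p, hp, hpΩ⟩ :=
    exists_surjective_standardSymplectic Ω (fun u => by rw [hΩ, lie_self, map_zero])
  have hpz : p z = 0 := eq_zero_of_form_eq_zero hp hpΩ (by
    ext y
    rw [hΩ, ← lie_skew, hzc]
    simp)
  have hker : ∀ u, p u = 0 → ∃ t : ℝ, t • z = u := fun u hu => hcent u fun x => by
    rw [hlie, hpΩ, hu]
    simp [standardSymplectic]
  -- `ker p` is the line of `z`, on which `ζ` is a coordinate; so `p` and `ζ` together are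
  -- bijective.
  let e : 𝔤 →ₗ[ℝ] HeisenbergLieAlgebra m :=
    { toFun := fun u => ⟨(p u).1, (p u).2, ζ u⟩
      map_add' := fun u v => by ext1 <;> simp
      map_smul' := fun t u => by ext1 <;> simp }
  have he : Function.Bijective e := by
    refine ⟨(injective_iff_map_eq_zero e).2 fun u hu => ?_, fun q => ?_⟩
    · have hx : (p u).1 = 0 := congrArg HeisenbergLieAlgebra.x hu
      have hy : (p u).2 = 0 := congrArg HeisenbergLieAlgebra.y hu
      have hu' : ζ u = 0 := congrArg HeisenbergLieAlgebra.z hu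
      obtain ⟨t, rfl⟩ := hker u (Prod.ext hx hy)
      rw [map_smul, hζ, smul_eq_mul, mul_one] at hu'
      rw [hu', zero_smul]
    · obtain ⟨v, hv⟩ := hp (q.x, q.y)
      refine ⟨v + (q.z - ζ v) • z, ?_⟩
      ext1 <;> simp [e, hpz, hζ, hv]
  have helie : ∀ u v, e ⁅u, v⁆ = ⁅e u, e v⁆ := fun u v => by
    have h0 : p ⁅u, v⁆ = 0 := by rw [hlie, map_smul, hpz, smul_zero]
    ext1
    · simp [e, h0]
    · simp [e, h0]
    · rw [HeisenbergLieAlgebra.lie_z]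
      exact hpΩ u v
  refine ⟨m, Nat.pos_of_ne_zero ?_, ⟨{ LinearEquiv.ofBijective e he with
    map_lie' := fun {u v} => helie u v }⟩⟩
  rintro rfl
  have hbot : firstDerivedIdeal 𝔤 = ⊥ := by
    rw [LieSubmodule.lie_eq_bot_iff]
    intro x _ y _
    rw [hlie, hpΩ]
    simp [standardSymplectic]
  rw [hbot, LieSubmodule.mem_bot] at hzD
  exact hz0 hzD

end LieAlgebra

noncomputable section TwoStepGroups

/-! ### Two-step nilpotent Lie groups -/

/-- A two-step nilpotent Lie bracket on `ℝⁿ`. -/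
structure TwoStepBracket (n : ℕ) where
  /-- The bracket, as a continuous bilinear map. -/
  form : EuclideanSpace ℝ (Fin n) →L[ℝ] EuclideanSpace ℝ (Fin n) →L[ℝ] EuclideanSpace ℝ (Fin n)
  form_self : ∀ x, form x x = 0
  form_form : ∀ x y w, form (form x y) w = 0

namespace TwoStepBracket

variable {n : ℕ} (β : TwoStepBracket n)

theorem form_skew (x y : EuclideanSpace ℝ (Fin n)) : β.form x y = -β.form y x := by
  have h := β.form_self (x + y)
  simp only [map_add, add_apply, form_self, zero_add, add_zero] at h
  exact eq_neg_of_add_eq_zero_right h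

theorem form_form_right (w x y : EuclideanSpace ℝ (Fin n)) : β.form w (β.form x y) = 0 := by
  rw [form_skew, form_form, neg_zero]

/-- The simply connected Lie group with Lie algebra `(ℝⁿ, β)`: the space `ℝⁿ` with the product
`x * y = x + y + β(x, y) / 2` given by the Baker-Campbell-Hausdorff formula. -/
def Group (_ : TwoStepBracket n) : Type := EuclideanSpace ℝ (Fin n)

namespace Group

instance : TopologicalSpace β.Group := inferInstanceAs (TopologicalSpace (EuclideanSpace ℝ (Fin n)))
instance : T2Space β.Group := inferInstanceAs (T2Space (EuclideanSpace ℝ (Fin n)))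
instance : SecondCountableTopology β.Group :=
  inferInstanceAs (SecondCountableTopology (EuclideanSpace ℝ (Fin n)))
instance : ChartedSpace (EuclideanSpace ℝ (Fin n)) β.Group :=
  inferInstanceAs (ChartedSpace (EuclideanSpace ℝ (Fin n)) (EuclideanSpace ℝ (Fin n)))
instance : IsManifold (𝓡 n) ∞ β.Group :=
  inferInstanceAs (IsManifold (𝓡 n) ∞ (EuclideanSpace ℝ (Fin n)))

/-- The product on `ℝⁿ`. -/
def mulVec (x y : EuclideanSpace ℝ (Fin n)) : EuclideanSpace ℝ (Fin n) :=
  x + y + (2⁻¹ : ℝ) • β.form x y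

theorem mulVec_assoc (x y w : EuclideanSpace ℝ (Fin n)) :
    mulVec β (mulVec β x y) w = mulVec β x (mulVec β y w) := by
  simp only [mulVec, map_add, map_smul, add_apply, smul_apply, form_form, form_form_right]
  module

theorem neg_mulVec_self (x : EuclideanSpace ℝ (Fin n)) : mulVec β (-x) x = 0 := by
  simp [mulVec, form_self]

theorem mulVec_conj (g x : EuclideanSpace ℝ (Fin n)) :
    mulVec β (mulVec β g x) (-g) = x + β.form g x := by
  simp only [mulVec, map_add, map_smul, map_neg, add_apply, smul_apply, form_form, form_self]
  rw [form_skew β x g]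
  module

theorem zero_mulVec (x : EuclideanSpace ℝ (Fin n)) : mulVec β 0 x = x := by
  simp [mulVec]

theorem mulVec_zero (x : EuclideanSpace ℝ (Fin n)) : mulVec β x 0 = x := by
  simp [mulVec]

instance : _root_.Group β.Group where
  mul x y := mulVec β x y
  one := (0 : EuclideanSpace ℝ (Fin n))
  inv x := Neg.neg (α := EuclideanSpace ℝ (Fin n)) x
  mul_assoc := mulVec_assoc β
  one_mul := zero_mulVec β
  mul_one := mulVec_zero β
  inv_mul_cancel := neg_mulVec_self β

instance : LieGroup (𝓡 n) ∞ β.Group where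
  contMDiff_mul := by
    have h1 : ContMDiff ((𝓡 n).prod (𝓡 n)) (𝓡 n) ∞ (fun p : EuclideanSpace ℝ (Fin n) ×
        EuclideanSpace ℝ (Fin n) => p.1) := contMDiff_fst
    have h2 : ContMDiff ((𝓡 n).prod (𝓡 n)) (𝓡 n) ∞ (fun p : EuclideanSpace ℝ (Fin n) ×
        EuclideanSpace ℝ (Fin n) => p.2) := contMDiff_snd
    have h3 : ContMDiff ((𝓡 n).prod (𝓡 n)) (𝓡 n) ∞ (fun p : EuclideanSpace ℝ (Fin n) ×
        EuclideanSpace ℝ (Fin n) => (2⁻¹ : ℝ) • β.form p.1 p.2) :=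
      (((2⁻¹ : ℝ) • β.form).contDiff.contMDiff.comp h1).clm_apply h2
    have h4 : ContMDiff ((𝓡 n).prod (𝓡 n)) (𝓡 n) ∞ (fun p : EuclideanSpace ℝ (Fin n) ×
        EuclideanSpace ℝ (Fin n) => mulVec β p.1 p.2) :=
      (h1.add h2).add h3
    exact h4
  contMDiff_inv := by
    have h : ContMDiff (𝓡 n) (𝓡 n) ∞ (fun x : EuclideanSpace ℝ (Fin n) => -x) :=
      contDiff_neg.contMDiff
    exact h

theorem mulInvariantVectorField_eq (v g : EuclideanSpace ℝ (Fin n)) :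
    mulInvariantVectorField (I := 𝓡 n) (G := β.Group) v g = v + (2⁻¹ : ℝ) • β.form g v := by
  change mfderiv 𝓘(ℝ, EuclideanSpace ℝ (Fin n)) 𝓘(ℝ, EuclideanSpace ℝ (Fin n))
    (mulVec β g) 0 v = _
  rw [mfderiv_eq_fderiv]
  have : HasFDerivAt (mulVec β g) (ContinuousLinearMap.id ℝ _ + (2⁻¹ : ℝ) • β.form g) 0 :=
    ((hasFDerivAt_id _).const_add g).add ((β.form g).hasFDerivAt.const_smul (2⁻¹ : ℝ))
  rw [this.fderiv]
  rfl

/-- The invariant fields are affine, and their bracket at the identity is `β(v, w) / 2 - β(w, v) /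
2`; the factor `2⁻¹` in the product is what makes this `β(v, w)`. -/
theorem bracket_eq (v w : EuclideanSpace ℝ (Fin n)) :
    Bracket.bracket (L := GroupLieAlgebra (𝓡 n) β.Group) (M := GroupLieAlgebra (𝓡 n) β.Group) v w =
      β.form v w := by
  have hfield (u : EuclideanSpace ℝ (Fin n)) :
      mulInvariantVectorField (I := 𝓡 n) (G := β.Group) u =
        fun g : EuclideanSpace ℝ (Fin n) => u + (2⁻¹ : ℝ) • β.form g u :=
    funext (mulInvariantVectorField_eq β u)
  have hder (u : EuclideanSpace ℝ (Fin n)) :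
      HasFDerivAt (fun g : EuclideanSpace ℝ (Fin n) => u + (2⁻¹ : ℝ) • β.form g u)
        ((2⁻¹ : ℝ) • β.form.flip u) 0 :=
    ((β.form.flip u).hasFDerivAt.const_smul (2⁻¹ : ℝ)).const_add u
  change VectorField.mlieBracketWithin (𝓡 n)
    (mulInvariantVectorField (I := 𝓡 n) (G := β.Group) v)
    (mulInvariantVectorField (I := 𝓡 n) (G := β.Group) w) Set.univ (1 : β.Group) = _
  rw [hfield v, hfield w]
  have hvec (V W : EuclideanSpace ℝ (Fin n) → EuclideanSpace ℝ (Fin n)) :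
      VectorField.mlieBracketWithin 𝓘(ℝ, EuclideanSpace ℝ (Fin n)) V W Set.univ 0 =
        VectorField.lieBracket ℝ V W 0 := by
    rw [← VectorField.lieBracketWithin_univ]
    exact congrFun VectorField.mlieBracketWithin_eq_lieBracketWithin 0
  have hlie : VectorField.lieBracket ℝ
      (fun g : EuclideanSpace ℝ (Fin n) => v + (2⁻¹ : ℝ) • β.form g v)
      (fun g : EuclideanSpace ℝ (Fin n) => w + (2⁻¹ : ℝ) • β.form g w) 0 = β.form v w := by
    rw [VectorField.lieBracket_eq]
    simp only [(hder _).fderiv, map_zero, zero_apply, smul_zero, add_zero, smul_apply,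
      ContinuousLinearMap.flip_apply]
    rw [form_skew β w v]
    module
  exact (hvec _ _).trans hlie

theorem lieGroupAd_inv_eq (g : EuclideanSpace ℝ (Fin n)) :
    lieGroupAd n (G := β.Group) (Inv.inv (α := β.Group) g) =
      ContinuousLinearMap.id ℝ _ - β.form g := by
  have h : (fun x : EuclideanSpace ℝ (Fin n) => mulVec β (mulVec β (-g) x) (- -g)) =
      fun x => x + β.form (-g) x := funext (mulVec_conj β (-g))
  change mfderiv 𝓘(ℝ, EuclideanSpace ℝ (Fin n)) 𝓘(ℝ, EuclideanSpace ℝ (Fin n))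
    (fun x : EuclideanSpace ℝ (Fin n) => mulVec β (mulVec β (-g) x) (- -g)) 0 = _
  have h' : HasFDerivAt (fun x : EuclideanSpace ℝ (Fin n) => x + β.form (-g) x)
      (ContinuousLinearMap.id ℝ _ + β.form (-g)) 0 :=
    (hasFDerivAt_id _).add (β.form (-g)).hasFDerivAt
  rw [h, mfderiv_eq_fderiv, h'.fderiv, map_neg, sub_eq_add_neg]

/-- The coadjoint orbit of `F` has the dimension of the space of all functionals
`F ∘ β(X, ·)`. -/
theorem coadjointOrbitDim_eq (F : StrongDual ℝ (EuclideanSpace ℝ (Fin n))) :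
    coadjointOrbitDim n β.Group F =
      Module.finrank ℝ (LinearMap.range
        (ContinuousLinearMap.compL ℝ _ _ _ F ∘L β.form).toLinearMap) := by
  -- The orbit map is affine in `g`, so its differential is its linear part, and the sign does not
  -- affect the range.
  have h : (fun g : EuclideanSpace ℝ (Fin n) => coadjoint n (G := β.Group) g F) =
      fun g => F - (ContinuousLinearMap.compL ℝ _ _ _ F ∘L β.form) g := by
    funext g
    change F.comp (lieGroupAd n (G := β.Group) (Inv.inv (α := β.Group) g)) = _
    rw [lieGroupAd_inv_eq]
    ext x
    simp
  have h' : HasFDerivAt (fun g : EuclideanSpace ℝ (Fin n) => coadjoint n (G := β.Group) g F)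
      (-(ContinuousLinearMap.compL ℝ _ _ _ F ∘L β.form)) 0 := by
    rw [h]
    exact (ContinuousLinearMap.hasFDerivAt _).const_sub F
  have hrange : LinearMap.range
      (-(ContinuousLinearMap.compL ℝ _ _ _ F ∘L β.form)).toLinearMap =
      LinearMap.range (ContinuousLinearMap.compL ℝ _ _ _ F ∘L β.form).toLinearMap :=
    LinearMap.range_neg _
  exact (congrArg (fun T : EuclideanSpace ℝ (Fin n) →L[ℝ] StrongDual ℝ (EuclideanSpace ℝ (Fin n)) =>
    Module.finrank ℝ (LinearMap.range T.toLinearMap)) (mfderiv_eq_fderiv.trans h'.fderiv)).trans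
    (congrArg (fun S : Submodule ℝ (StrongDual ℝ (EuclideanSpace ℝ (Fin n))) =>
      Module.finrank ℝ S) hrange)

theorem mulVec_commutator (g x : EuclideanSpace ℝ (Fin n)) :
    mulVec β (mulVec β (mulVec β g x) (-g)) (-x) = β.form g x := by
  rw [mulVec_conj, mulVec, map_add, add_apply, map_neg, map_neg, form_self, form_form]
  module

theorem mulVec_form_comm (g x y : EuclideanSpace ℝ (Fin n)) :
    mulVec β y (β.form g x) = mulVec β (β.form g x) y := by
  rw [mulVec, mulVec, form_form, form_form_right, add_comm y]

/-- A group commutator is a single value of `β`, and such values are annihilated by `β` on either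
side. -/
theorem commutator_le_center : commutator β.Group ≤ Subgroup.center β.Group := by
  rw [commutator_def, Subgroup.commutator_le]
  intro g _ x _
  rw [Subgroup.mem_center_iff]
  intro y
  have h : g * x * g⁻¹ * x⁻¹ = β.form g x := mulVec_commutator β g x
  change y * (g * x * g⁻¹ * x⁻¹) = (g * x * g⁻¹ * x⁻¹) * y
  rw [h]
  exact mulVec_form_comm β g x y

instance isSolvable : _root_.Group.IsSolvable β.Group := by
  refine ⟨2, ?_⟩
  rw [derivedSeries_succ, derivedSeries_one, Subgroup.commutator_eq_bot_iff_le_centralizer]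
  exact (commutator_le_center β).trans (Subgroup.center_le_centralizer _)

end Group
end TwoStepBracket

end TwoStepGroups

/-! ### Lie algebras with one-dimensional central derived ideal -/

section LieAlgebra

variable {𝔤 : Type*} [LieRing 𝔤] [LieAlgebra ℝ 𝔤] {Ω : 𝔤 → 𝔤 → ℝ} {z : 𝔤}

/-- A nonabelian Lie algebra whose bracket takes values in its one-dimensional center is
indecomposable. -/
theorem isIndecomposable_of_center_eq_span (hz : z ≠ 0) (hlie : ∀ x y : 𝔤, ⁅x, y⁆ = Ω x y • z)
    (hcent : ∀ c : 𝔤, (∀ x : 𝔤, ⁅x, c⁆ = 0) → ∃ t : ℝ, t • z = c) :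
    IsIndecomposableLieAlgebra 𝔤 := by
  -- A nonzero element of `A` is either central, hence a multiple of `z`, or has a nonzero bracket,
  -- which is again a multiple of `z`.
  have hmem : ∀ A : LieIdeal ℝ 𝔤, A ≠ ⊥ → z ∈ A := by
    intro A hA
    obtain ⟨a, ha, ha0⟩ : ∃ a ∈ A, a ≠ 0 := by
      simpa [LieSubmodule.eq_bot_iff] using hA
    suffices ∃ t : ℝ, t ≠ 0 ∧ t • z ∈ A by
      obtain ⟨t, ht, htA⟩ := this
      simpa [smul_smul, ht] using A.smul_mem t⁻¹ htA
    by_cases hc : ∀ x : 𝔤, ⁅x, a⁆ = 0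
    · obtain ⟨t, rfl⟩ := hcent a hc
      exact ⟨t, fun h => ha0 (by rw [h, zero_smul]), ha⟩
    · push Not at hc
      obtain ⟨x, hx⟩ := hc
      refine ⟨Ω x a, fun h => hx (by rw [hlie, h, zero_smul]), ?_⟩
      rw [← hlie]
      exact lie_mem_right ℝ 𝔤 A x a ha
  rintro ⟨A, B, hA, hB, hAB⟩
  have : z ∈ A ⊓ B := ⟨hmem A hA, hmem B hB⟩
  rw [hAB.inf_eq_bot, LieSubmodule.mem_bot] at this
  exact hz this

theorem finrank_firstDerivedIdeal_eq_one (hz : z ≠ 0) (hlie : ∀ x y : 𝔤, ⁅x, y⁆ = Ω x y • z)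
    (hmem : ∃ x y : 𝔤, ⁅x, y⁆ = z) : Module.finrank ℝ (firstDerivedIdeal 𝔤) = 1 := by
  have h : (firstDerivedIdeal 𝔤).toSubmodule = Submodule.span ℝ {z} := by
    apply le_antisymm
    · rw [LieSubmodule.lieIdeal_oper_eq_linear_span', Submodule.span_le]
      rintro _ ⟨x, _, y, _, rfl⟩
      exact Submodule.mem_span_singleton.2 ⟨Ω x y, (hlie x y).symm⟩
    · rw [Submodule.span_singleton_le_iff_mem]
      obtain ⟨x, y, rfl⟩ := hmem
      exact lie_mem_firstDerivedIdeal x y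
  change Module.finrank ℝ (firstDerivedIdeal 𝔤).toSubmodule = 1
  rw [h, finrank_span_singleton hz]

/-- A Lie algebra whose bracket takes values in a central line is an MD-algebra. -/
theorem isMDAlgebra_of_central_line [FiniteDimensional ℝ 𝔤] {n : ℕ}
    (hdim : Module.finrank ℝ 𝔤 = n) (hlie : ∀ x y : 𝔤, ⁅x, y⁆ = Ω x y • z)
    (hzc : ∀ x : 𝔤, ⁅z, x⁆ = 0) : IsMDAlgebra n 𝔤 := by
  let φ : 𝔤 ≃ₗ[ℝ] EuclideanSpace ℝ (Fin n) :=
    LinearEquiv.ofFinrankEq _ _ (by rw [hdim, finrank_euclideanSpace_fin])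
  let b : EuclideanSpace ℝ (Fin n) →ₗ[ℝ] EuclideanSpace ℝ (Fin n) →ₗ[ℝ]
      EuclideanSpace ℝ (Fin n) :=
    LinearMap.mk₂ ℝ (fun x y => φ ⁅φ.symm x, φ.symm y⁆) (by simp) (by simp) (by simp) (by simp)
  let β : TwoStepBracket n :=
    { form := (LinearMap.toContinuousLinearMap.toLinearMap ∘ₗ b).toContinuousLinearMap
      form_self := fun x => by
        change φ ⁅φ.symm x, φ.symm x⁆ = 0
        simp
      form_form := fun x y w => by
        change φ ⁅φ.symm (φ ⁅φ.symm x, φ.symm y⁆), φ.symm w⁆ = 0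
        rw [LinearEquiv.symm_apply_apply, hlie (φ.symm x), smul_lie, hzc, smul_zero, map_zero] }
  have hβ : ∀ x y, β.form x y = φ ⁅φ.symm x, φ.symm y⁆ := fun x y => rfl
  have hβ' : ∀ x y, β.form x y = Ω (φ.symm x) (φ.symm y) • φ z := fun x y => by
    rw [hβ, hlie, map_smul]
  refine ⟨β.Group, inferInstance, inferInstance, inferInstance, inferInstance,
    ⟨inferInstance, inferInstance, inferInstance, fun F => ?_⟩,
    ⟨{ toFun := φ
       invFun := φ.symm
       map_add' := map_add φ
       map_smul' := map_smul φ
       map_lie' := fun {x y} => ?_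
       left_inv := φ.left_inv
       right_inv := φ.right_inv }⟩⟩
  · simp only [TwoStepBracket.Group.coadjointOrbitDim_eq]
    by_cases hF : F (φ z) = 0
    · left
      have h0 : ContinuousLinearMap.compL ℝ _ _ _ F ∘L β.form = 0 := by
        ext x y
        simp [hβ', hF]
      rw [h0]
      simp
    · right
      intro F'
      apply Submodule.finrank_mono
      rintro _ ⟨x, rfl⟩
      -- `F` enters the differential only through the scalar `F (φ z)`, so rescaling `x` turns the
      -- functional for `F` into the one for `F'`.
      refine ⟨(F' (φ z) / F (φ z)) • x, ?_⟩
      ext y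
      simp [hβ']
      field_simp
  · change φ ⁅x, y⁆ = Bracket.bracket (L := GroupLieAlgebra (𝓡 n) β.Group)
      (M := GroupLieAlgebra (𝓡 n) β.Group) (φ x) (φ y)
    rw [TwoStepBracket.Group.bracket_eq, hβ, LinearEquiv.symm_apply_apply,
      LinearEquiv.symm_apply_apply]

end LieAlgebra

/-! ### The Heisenberg Lie algebras -/

namespace HeisenbergLieAlgebra

variable {m : ℕ}

theorem finrank_eq (m : ℕ) : Module.finrank ℝ (HeisenbergLieAlgebra m) = 2 * m + 1 := by
  have e : HeisenbergLieAlgebra m ≃ₗ[ℝ] (Fin m → ℝ) × (Fin m → ℝ) × ℝ :=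
    { coords m with
      map_add' := fun _ _ => rfl
      map_smul' := fun _ _ => rfl }
  rw [e.finrank_eq]
  simp
  ring

/-- The central basis vector `Z`. -/
def center (m : ℕ) : HeisenbergLieAlgebra m := ⟨0, 0, 1⟩

theorem lie_eq (u v : HeisenbergLieAlgebra m) :
    ⁅u, v⁆ = standardSymplectic (u.x, u.y) (v.x, v.y) • center m := by
  ext1 <;> simp [center, standardSymplectic]

theorem eq_smul_center_of_central (c : HeisenbergLieAlgebra m)
    (hc : ∀ u : HeisenbergLieAlgebra m, ⁅c, u⁆ = 0) : c.z • center m = c := by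
  have h : (c.x, c.y) = (0 : (Fin m → ℝ) × (Fin m → ℝ)) :=
    eq_zero_of_standardSymplectic_eq_zero fun q =>
      congrArg HeisenbergLieAlgebra.z (hc ⟨q.1, q.2, 0⟩)
  ext1
  · simpa [center] using (congrArg Prod.fst h).symm
  · simpa [center] using (congrArg Prod.snd h).symm
  · simp [center]

theorem exists_lie_eq_center (hm : 0 < m) : ∃ u v : HeisenbergLieAlgebra m, ⁅u, v⁆ = center m := by
  refine ⟨⟨Pi.single ⟨0, hm⟩ 1, 0, 0⟩, ⟨0, Pi.single ⟨0, hm⟩ 1, 0⟩, ?_⟩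
  ext1 <;> simp [center, Pi.single_apply]

end HeisenbergLieAlgebra

/-- A Lie algebra isomorphic to a Heisenberg Lie algebra is an indecomposable MD-algebra with
one-dimensional derived ideal. -/
theorem isMDAlgebra_of_equiv_heisenberg {𝔤 : Type*} [LieRing 𝔤] [LieAlgebra ℝ 𝔤]
    [FiniteDimensional ℝ 𝔤] {m : ℕ} (hm : 0 < m) (e : 𝔤 ≃ₗ⁅ℝ⁆ HeisenbergLieAlgebra m) :
    IsIndecomposableLieAlgebra 𝔤 ∧ IsMDAlgebra (Module.finrank ℝ 𝔤) 𝔤 ∧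
      Module.finrank ℝ (firstDerivedIdeal 𝔤) = 1 := by
  have hlie (x y : 𝔤) : ⁅x, y⁆ =
      standardSymplectic ((e x).x, (e x).y) ((e y).x, (e y).y) •
        e.symm (HeisenbergLieAlgebra.center m) := by
    apply e.injective
    change e _ = e _
    rw [LieEquiv.map_lie, HeisenbergLieAlgebra.lie_eq, map_smul, e.apply_symm_apply]
  have hz : e.symm (HeisenbergLieAlgebra.center m) ≠ 0 := fun h => by
    have h' := congrArg e h
    rw [e.apply_symm_apply, map_zero] at h'
    exact one_ne_zero (congrArg HeisenbergLieAlgebra.z h')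
  refine ⟨isIndecomposable_of_center_eq_span hz hlie fun c hc => ⟨(e c).z, ?_⟩,
    isMDAlgebra_of_central_line rfl hlie fun x => ?_,
    finrank_firstDerivedIdeal_eq_one hz hlie ?_⟩
  · apply e.injective
    change e _ = e _
    rw [map_smul, e.apply_symm_apply, HeisenbergLieAlgebra.eq_smul_center_of_central]
    intro u
    rw [← e.apply_symm_apply u, ← LieEquiv.map_lie, ← lie_skew, hc, neg_zero, map_zero]
  · rw [hlie, e.apply_symm_apply]
    simp [standardSymplectic, HeisenbergLieAlgebra.center]
  · obtain ⟨u, v, huv⟩ := HeisenbergLieAlgebra.exists_lie_eq_center hm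
    refine ⟨e.symm u, e.symm v, ?_⟩
    rw [← LieEquiv.map_lie, huv]

theorem mainTheorem4 (n : ℕ) (hn : 3 ≤ n) (𝔤 : Type*) [LieRing 𝔤] [LieAlgebra ℝ 𝔤]
    (hdim : Module.finrank ℝ 𝔤 = n) :
    List.TFAE [
      IsIndecomposableLieAlgebra 𝔤 ∧ Module.finrank ℝ (firstDerivedIdeal 𝔤) = 1,
      IsIndecomposableLieAlgebra 𝔤 ∧ IsMDAlgebraWithDerivedDim n 1 𝔤,
      ∃ m : ℕ, 0 < m ∧ n = 2 * m + 1 ∧ Nonempty (𝔤 ≃ₗ⁅ℝ⁆ HeisenbergLieAlgebra m)] ∧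
    ((∃ m : ℕ, 0 < m ∧ Nonempty (𝔤 ≃ₗ⁅ℝ⁆ HeisenbergLieAlgebra m)) → Odd n) := by
  -- `Module.finrank` is `0` in infinite dimension, so `3 ≤ n` forces finiteness.
  have hfin : FiniteDimensional ℝ 𝔤 := Module.finite_of_finrank_pos (by omega)
  have hodd : ∀ m : ℕ, Nonempty (𝔤 ≃ₗ⁅ℝ⁆ HeisenbergLieAlgebra m) → n = 2 * m + 1 := by
    rintro m ⟨e⟩
    rw [← hdim, e.toLinearEquiv.finrank_eq, HeisenbergLieAlgebra.finrank_eq]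
  refine ⟨?_, fun ⟨m, _, h⟩ => ⟨m, hodd m h⟩⟩
  tfae_have 1 → 3 := by
    rintro ⟨hind, hD⟩
    obtain ⟨m, hm, e⟩ := exists_equiv_heisenberg (by omega) hind hD
    exact ⟨m, hm, hodd m e, e⟩
  tfae_have 3 → 2 := by
    rintro ⟨m, hm, _, ⟨e⟩⟩
    obtain ⟨h1, h2, h3⟩ := isMDAlgebra_of_equiv_heisenberg hm e
    exact ⟨h1, one_pos, by omega, hdim ▸ h2, h3⟩
  tfae_have 2 → 1 := fun h => ⟨h.1, h.2.2.2.2⟩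
  tfae_finish
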